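/- For $p\in(1,\infty)$ let $\ell^p_A$ be the space of analytic functions $f(z)=\sum_{k\ge 0}a_kz^k$ on the open unit disk $\mathbb{D}=\{z\in\mathbb{C}:|z|<1\}$ with $\sum_{k\ge 0}|a_k|^p<\infty$. A sequence $(w_k)_{k\ge1}$ of points of $\mathbb{D}$ (repetitions allowed) is called a zero set for $\ell^p_A$ if there is an $f\in\ell^p_A$, not identically zero, that vanishes at every $w_k$, counting multiplicity: if a point $s\in\mathbb{D}$ occurs $n$ times in the sequence, $0\le n\le\infty$, then $f^{(m)}(s)=0$ for every integer $m$ with $0\le m<n$. (The function $f$ may have further zeros, or zeros of higher multiplicity.) Theorem. For every real $p>2$ there exists a sequence $(w_k)_{k\ge1}\subset\mathbb{D}$ that is not a Blaschke sequence, i.e. $$\sum_{k\ge1}(1-|w_k|)=\infty,$$ and that is a zero set for $\ell^p_A$. -/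

import Mathlib

open scoped ENNReal Complex.UnitDisc

/-- The space of power series `∑ aₖ zᵏ` with `(aₖ) ∈ ℓ^p`, identified with `ℓ^p(ℕ, ℂ)` through
Taylor coefficients; it carries the `ℓ^p` norm. -/
abbrev EllA (p : ℝ≥0∞) : Type := lp (fun _ : ℕ => ℂ) p

namespace EllA

/-- The function `f(z) = ∑ aₖ zᵏ` with Taylor coefficients `aₖ = f k`. The series converges
absolutely for `‖z‖ < 1`; the values for other `z` are irrelevant. -/
noncomputable def eval {p : ℝ≥0∞} (f : EllA p) (z : ℂ) : ℂ := ∑' k : ℕ, f k * z ^ k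

/-- `𝓡_W`: all `f` in the space that vanish on the sequence `W = (wₖ)`, counting multiplicity: if
`s` occurs `n ∈ {0, 1, …, ∞}` times in `W`, then `f, f', …` vanish at `s` for all derivatives of
order less than `n`. -/
def vanishingOn (p : ℝ≥0∞) (w : ℕ → 𝔻) : Set (EllA p) :=
  {f | ∀ (s : 𝔻) (m : ℕ), (m : ℕ∞) < {k : ℕ | w k = s}.encard →
    iteratedDeriv m f.eval (s : ℂ) = 0}

/-- `W = (wₖ)` is a zero set (zero sequence) if `𝓡_W ≠ {0}`. -/
def IsZeroSet (p : ℝ≥0∞) (w : ℕ → 𝔻) : Prop := vanishingOn p w ≠ {0}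

end EllA

/-- The Blaschke condition `∑ (1 - |wₖ|) < ∞`. -/
def IsBlaschke (w : ℕ → 𝔻) : Prop := Summable fun k => 1 - ‖(w k : ℂ)‖

namespace EllA

/-! The witness is `f(z) = ∏ P_J(z^((J+1)!))` with `P_J(z) = 1 - 2/(J+1) * (z + ⋯ + z^(J+1))`. Each
`k` has a unique factorial-base expansion whose digit at place `(J+1)!` is at most `J+1`, so no
terms of the product collide: the coefficient at `k` is a product over its digits (`coeff_eq_mul`).
Hence the `p`-th power sum of the coefficients factors as `∏ (1 + (J+1) * (2/(J+1))^p)`, finite for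
`p > 2`. `P_J` has a root in `[1/2, 1)` at distance at least `1/(2(J+1))` from `1`. Its `(J+1)!`
roots of order `(J+1)!` together contribute at least that much to the Blaschke sum, which therefore
dominates a harmonic series (`not_summable_one_sub_norm_zero`). -/

/-- Splitting a sum over `k < n * m` according to the quotient and the remainder of `k` by `n`. -/
theorem sum_range_mul_div_mod {R : Type*} [CommSemiring R] (n m : ℕ) (g h : ℕ → R) :
    ∑ k ∈ Finset.range (n * m), g (k / n) * h (k % n) =
      (∑ d ∈ Finset.range m, g d) * ∑ r ∈ Finset.range n, h r := by
  induction m with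
  | zero => simp
  | succ m ih =>
    rw [Nat.mul_succ, Finset.sum_range_add, ih, Finset.sum_range_succ, add_mul,
      Finset.mul_sum _ _ (g m)]
    congr 1
    refine Finset.sum_congr rfl fun r hr => ?_
    have hr' := Finset.mem_range.1 hr
    rw [Nat.mul_add_mod, Nat.mod_eq_of_lt hr', Nat.mul_add_div (by omega), Nat.div_eq_of_lt hr',
      add_zero]

/-- Coefficients of the polynomial `1 - 2 / (J + 1) * (z + ⋯ + z ^ (J + 1))`. -/
noncomputable def digitCoeff (J d : ℕ) : ℂ := if d = 0 then 1 else -2 / ((J : ℂ) + 1)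

/-- Coefficients of the product over `j < J` of the polynomials with coefficients `digitCoeff j`,
evaluated at `z ^ (j + 1)!`. -/
noncomputable def prodCoeff : ℕ → ℕ → ℂ
  -- Only the value at `k = 0` matters, since remainders modulo `1!` vanish. Likewise `prodCoeff J
  -- k` is meaningful only for `k < (J + 1)!`.
  | 0, _ => 1
  | J + 1, k => digitCoeff J (k / (J + 1).factorial) * prodCoeff J (k % (J + 1).factorial)

theorem prodCoeff_succ_of_lt {J k : ℕ} (h : k < (J + 1).factorial) :
    prodCoeff (J + 1) k = prodCoeff J k := by
  simp [prodCoeff, Nat.div_eq_of_lt h, Nat.mod_eq_of_lt h, digitCoeff]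

theorem prodCoeff_of_le {J M k : ℕ} (h : k < (J + 1).factorial) (hJM : J ≤ M) :
    prodCoeff M k = prodCoeff J k := by
  induction M, hJM using Nat.le_induction with
  | base => rfl
  | succ M hM ih =>
    rw [prodCoeff_succ_of_lt (h.trans_le (Nat.factorial_le (by omega))), ih]

/-- Coefficients of the infinite product. -/
noncomputable def coeff (k : ℕ) : ℂ := prodCoeff k k

theorem coeff_zero : coeff 0 = 1 := rfl

/-- Later factors only see digits at places `(J + 1)!` and above, which are zero here. -/
theorem coeff_eq_prodCoeff {J k : ℕ} (h : k < (J + 1).factorial) : coeff k = prodCoeff J k := by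
  have hk : k < (k + 1).factorial := (Nat.lt_succ_self k).trans_le (Nat.self_le_factorial _)
  rcases le_total J k with hJ | hJ
  · exact prodCoeff_of_le h hJ
  · exact (prodCoeff_of_le hk hJ).symm

theorem coeff_eq_mul {J k : ℕ} (h : k < (J + 2).factorial) :
    coeff k = digitCoeff J (k / (J + 1).factorial) * coeff (k % (J + 1).factorial) := by
  rw [coeff_eq_prodCoeff (J := J + 1) h, prodCoeff,
    coeff_eq_prodCoeff (Nat.mod_lt _ (Nat.factorial_pos _))]

theorem sum_coeff_mul_pow (J : ℕ) (z : ℂ) :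
    ∑ k ∈ Finset.range (J + 2).factorial, coeff k * z ^ k =
      (∑ d ∈ Finset.range (J + 2), digitCoeff J d * (z ^ (J + 1).factorial) ^ d) *
        ∑ k ∈ Finset.range (J + 1).factorial, coeff k * z ^ k := by
  rw [← sum_range_mul_div_mod, mul_comm, ← Nat.factorial_succ]
  refine Finset.sum_congr rfl fun k hk => ?_
  rw [coeff_eq_mul (Finset.mem_range.1 hk)]
  have hz : z ^ k = (z ^ (J + 1).factorial) ^ (k / (J + 1).factorial) *
      z ^ (k % (J + 1).factorial) := by
    rw [← pow_mul, ← pow_add, Nat.div_add_mod]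
  rw [hz]
  ring

theorem sum_norm_coeff_rpow (J : ℕ) (p : ℝ) :
    ∑ k ∈ Finset.range (J + 2).factorial, ‖coeff k‖ ^ p =
      (1 + ((J : ℝ) + 1) * (2 / ((J : ℝ) + 1)) ^ p) *
        ∑ k ∈ Finset.range (J + 1).factorial, ‖coeff k‖ ^ p := by
  have h : ∑ d ∈ Finset.range (J + 2), ‖digitCoeff J d‖ ^ p =
      1 + ((J : ℝ) + 1) * (2 / ((J : ℝ) + 1)) ^ p := by
    have hn : ‖(J : ℂ) + 1‖ = (J : ℝ) + 1 := by
      exact_mod_cast Complex.norm_natCast (J + 1)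
    rw [Finset.sum_range_succ', add_comm]
    simp [digitCoeff, hn]
  rw [← h, ← sum_range_mul_div_mod, mul_comm, ← Nat.factorial_succ]
  refine Finset.sum_congr rfl fun k hk => ?_
  rw [coeff_eq_mul (Finset.mem_range.1 hk), norm_mul,
    Real.mul_rpow (norm_nonneg _) (norm_nonneg _)]

/-- The terms are `2^p * (J+1)^(1-p)`; this is where `p > 2` enters. -/
theorem summable_add_one_mul_two_div_rpow {p : ℝ} (hp : 2 < p) :
    Summable fun J : ℕ => ((J : ℝ) + 1) * (2 / ((J : ℝ) + 1)) ^ p := by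
  have h := ((summable_nat_add_iff 1).2
    (Real.summable_nat_rpow (p := 1 - p) |>.2 (by linarith))).mul_left ((2 : ℝ) ^ p)
  refine h.congr fun J => ?_
  have hJ : (0 : ℝ) < (J : ℝ) + 1 := by positivity
  push_cast
  rw [Real.div_rpow two_pos.le hJ.le, Real.rpow_sub hJ, Real.rpow_one]
  ring

theorem summable_norm_coeff_rpow {p : ℝ} (hp : 2 < p) : Summable fun k => ‖coeff k‖ ^ p := by
  set u : ℕ → ℝ := fun J => ((J : ℝ) + 1) * (2 / ((J : ℝ) + 1)) ^ p with hu
  have hu0 : ∀ J, 0 ≤ u J := fun J => by positivity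
  have hexp : ∀ J : ℕ, ∑ k ∈ Finset.range (J + 1).factorial, ‖coeff k‖ ^ p ≤
      Real.exp (∑ j ∈ Finset.range J, u j) := by
    intro J
    induction J with
    | zero => simp [coeff_zero]
    | succ J ih =>
      rw [sum_norm_coeff_rpow, Finset.sum_range_succ, add_comm (∑ j ∈ Finset.range J, u j),
        Real.exp_add]
      refine mul_le_mul ?_ ih (Finset.sum_nonneg fun _ _ => by positivity) (Real.exp_pos _).le
      rw [add_comm]
      exact Real.add_one_le_exp _
  refine summable_of_sum_range_le (c := Real.exp (∑' j, u j)) (fun k => by positivity) fun n => ?_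
  calc ∑ k ∈ Finset.range n, ‖coeff k‖ ^ p
      ≤ ∑ k ∈ Finset.range (n + 1).factorial, ‖coeff k‖ ^ p := by
        refine Finset.sum_le_sum_of_subset_of_nonneg (Finset.range_subset_range.2 ?_)
          fun _ _ _ => by positivity
        exact (Nat.le_succ n).trans (Nat.self_le_factorial _)
    _ ≤ _ := (hexp n).trans (Real.exp_le_exp.2
        ((summable_add_one_mul_two_div_rpow hp).sum_le_tsum _ fun j _ => hu0 j))

theorem memℓp_coeff {p : ℝ} (hp : 2 < p) :
    Memℓp (E := fun _ : ℕ => ℂ) coeff (ENNReal.ofReal p) := by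
  refine memℓp_gen ?_
  rw [ENNReal.toReal_ofReal (by linarith)]
  exact summable_norm_coeff_rpow hp

/-- The power series of an element of the space converges on the open unit disk. -/
theorem summable_mul_pow {p : ℝ≥0∞} (hp : p ≠ 0) (f : EllA p) {z : ℂ} (hz : ‖z‖ < 1) :
    Summable fun k => f k * z ^ k := by
  refine Summable.of_norm_bounded
    (g := fun k => ‖f‖ * ‖z‖ ^ k) ((summable_geometric_of_lt_one (norm_nonneg z) hz).mul_left _)
    fun k => ?_
  rw [norm_mul, norm_pow]
  exact mul_le_mul_of_nonneg_right (lp.norm_apply_le_norm hp f k) (by positivity)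

/-- Partial sums of factorial length are finite products, all zero once factor `J` is included; no
convergence theory for infinite products is needed. -/
theorem tsum_coeff_mul_pow_eq_zero {z : ℂ} (hs : Summable fun k => coeff k * z ^ k) {J : ℕ}
    (hz : ∑ d ∈ Finset.range (J + 2), digitCoeff J d * (z ^ (J + 1).factorial) ^ d = 0) :
    ∑' k, coeff k * z ^ k = 0 := by
  have hzero : ∀ M, J + 1 ≤ M →
      ∑ k ∈ Finset.range (M + 1).factorial, coeff k * z ^ k = 0 := by
    intro M hM
    induction M, hM using Nat.le_induction with
    | base => rw [sum_coeff_mul_pow, hz, zero_mul]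
    | succ M hM ih => rw [sum_coeff_mul_pow, ih, mul_zero]
  have hfac : Filter.Tendsto (fun M : ℕ => (M + 1).factorial) Filter.atTop Filter.atTop :=
    Filter.tendsto_atTop_mono (fun M => (Nat.le_succ M).trans (Nat.self_le_factorial _))
      Filter.tendsto_id
  refine tendsto_nhds_unique (hs.hasSum.tendsto_sum_nat.comp hfac)
    (tendsto_const_nhds.congr' ?_)
  filter_upwards [Filter.eventually_ge_atTop (J + 1)] with M hM
  exact (hzero M hM).symm

/-! ### Zeros of the factors -/

theorem exists_sum_pow_eq_half (N : ℕ) (hN : 1 ≤ N) :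
    ∃ x : ℝ, 0 ≤ x ∧ x < 1 ∧ ∑ d ∈ Finset.range N, x ^ (d + 1) = N / 2 := by
  have hN' : (1 : ℝ) ≤ N := by exact_mod_cast hN
  have hc : ContinuousOn (fun x : ℝ => ∑ d ∈ Finset.range N, x ^ (d + 1)) (Set.Icc 0 1) := by
    fun_prop
  obtain ⟨x, hx, hxe⟩ := intermediate_value_Icc zero_le_one hc
    (show (N / 2 : ℝ) ∈ _ by simp only [Set.mem_Icc]; constructor <;> simp; linarith)
  refine ⟨x, hx.1, lt_of_le_of_ne hx.2 ?_, hxe⟩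
  rintro rfl
  simp at hxe
  linarith

section Root

variable {N : ℕ} {x : ℝ} (hN : 1 ≤ N) (hx0 : 0 ≤ x) (hx1 : x < 1)
  (hx : ∑ d ∈ Finset.range N, x ^ (d + 1) = N / 2)

include hN hx0 hx1 hx

theorem half_le_of_sum_pow_eq_half : 1 / 2 ≤ x := by
  have hN' : (1 : ℝ) ≤ N := by exact_mod_cast hN
  have h : ∑ d ∈ Finset.range N, x ^ (d + 1) ≤ ∑ _d ∈ Finset.range N, x :=
    Finset.sum_le_sum fun d _ => pow_le_of_le_one hx0 hx1.le (Nat.succ_ne_zero d)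
  simp only [Finset.sum_const, Finset.card_range, nsmul_eq_mul, hx] at h
  nlinarith

theorem pow_succ_lt_half_of_sum_pow_eq_half : x ^ (N + 1) < 1 / 2 := by
  have hN' : (1 : ℝ) ≤ N := by exact_mod_cast hN
  have hpos : 0 < x := one_half_pos.trans_le (half_le_of_sum_pow_eq_half hN hx0 hx1 hx)
  have h : ∑ _d ∈ Finset.range N, x ^ N ≤ ∑ d ∈ Finset.range N, x ^ (d + 1) :=
    Finset.sum_le_sum fun d hd =>
      pow_le_pow_of_le_one hx0 hx1.le (Nat.succ_le_of_lt (Finset.mem_range.1 hd))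
  simp only [Finset.sum_const, Finset.card_range, nsmul_eq_mul, hx] at h
  have h2 : x ^ (N + 1) < x ^ N := pow_lt_pow_right_of_lt_one₀ hpos hx1 (Nat.lt_succ_self N)
  nlinarith

theorem inv_two_mul_le_of_sum_pow_eq_half : 1 / (2 * (N : ℝ)) ≤ 1 - x := by
  have hN' : (1 : ℝ) ≤ N := by exact_mod_cast hN
  have h : ∑ _d ∈ Finset.range N, (1 - N * (1 - x)) ≤ ∑ d ∈ Finset.range N, x ^ (d + 1) := by
    refine Finset.sum_le_sum fun d hd => ?_
    have hd' : ((d + 1 : ℕ) : ℝ) ≤ N := by exact_mod_cast Finset.mem_range.1 hd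
    -- Bernoulli's inequality bounds every term below by `1 - N(1 - x)`.
    have hb := one_add_mul_le_pow (a := x - 1) (by linarith) (d + 1)
    rw [add_sub_cancel] at hb
    nlinarith
  simp only [Finset.sum_const, Finset.card_range, nsmul_eq_mul, hx] at h
  rw [div_le_iff₀ (by positivity)]
  nlinarith

end Root

/-- The positive zero of `1 - 2 / (J + 1) * (z + ⋯ + z ^ (J + 1))`. -/
noncomputable def root (J : ℕ) : ℝ := (exists_sum_pow_eq_half (J + 1) (by omega)).choose

theorem root_nonneg (J : ℕ) : 0 ≤ root J :=
  (exists_sum_pow_eq_half (J + 1) (by omega)).choose_spec.1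

theorem root_lt_one (J : ℕ) : root J < 1 :=
  (exists_sum_pow_eq_half (J + 1) (by omega)).choose_spec.2.1

theorem sum_root_pow (J : ℕ) :
    ∑ d ∈ Finset.range (J + 1), root J ^ (d + 1) = ((J + 1 : ℕ) : ℝ) / 2 :=
  (exists_sum_pow_eq_half (J + 1) (by omega)).choose_spec.2.2

theorem half_le_root (J : ℕ) : 1 / 2 ≤ root J :=
  half_le_of_sum_pow_eq_half (by omega) (root_nonneg J) (root_lt_one J) (sum_root_pow J)

theorem sum_digitCoeff_mul_root_pow (J : ℕ) :
    ∑ d ∈ Finset.range (J + 2), digitCoeff J d * (root J : ℂ) ^ d = 0 := by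
  have h : ∑ d ∈ Finset.range (J + 1), (root J : ℂ) ^ (d + 1) = ((J : ℂ) + 1) / 2 := by
    simpa using congrArg Complex.ofReal (sum_root_pow J)
  have hJ : (J : ℂ) + 1 ≠ 0 := Nat.cast_add_one_ne_zero J
  rw [Finset.sum_range_succ']
  simp only [digitCoeff, Nat.succ_ne_zero, if_false, if_true, ← Finset.mul_sum, h, pow_zero]
  field_simp
  norm_num

/-- The modulus of the zeros of the `J`-th factor. -/
noncomputable def radius (J : ℕ) : ℝ := root J ^ (((J + 1).factorial : ℝ)⁻¹)

theorem radius_pow (J : ℕ) : radius J ^ (J + 1).factorial = root J :=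
  Real.rpow_inv_natCast_pow (root_nonneg J) (Nat.factorial_ne_zero _)

theorem radius_pos (J : ℕ) : 0 < radius J :=
  Real.rpow_pos_of_pos (one_half_pos.trans_le (half_le_root J)) _

theorem radius_lt_one (J : ℕ) : radius J < 1 :=
  Real.rpow_lt_one (root_nonneg J) (root_lt_one J) (by positivity)

/-- After raising to the power `(J+2)!`, this is `root J ^ (J+2) < 1/2 ≤ root (J+1)`. It keeps zeros
of different factors distinct, so multiplicities never arise. -/
theorem strictMono_radius : StrictMono radius := by
  refine strictMono_nat_of_lt_succ fun J => ?_
  refine lt_of_pow_lt_pow_left₀ (J + 2).factorial (radius_pos _).le ?_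
  rw [radius_pow (J + 1), Nat.factorial_succ, mul_comm, pow_mul, radius_pow]
  exact (pow_succ_lt_half_of_sum_pow_eq_half (by omega) (root_nonneg J) (root_lt_one J)
    (sum_root_pow J)).trans_le (half_le_root (J + 1))

/-- The right side is the Blaschke sum over one circle; Bernoulli bounds it below by `1 - root J`.
-/
theorem one_div_le_factorial_mul_one_sub_radius (J : ℕ) :
    1 / (2 * ((J + 1 : ℕ) : ℝ)) ≤ (J + 1).factorial * (1 - radius J) := by
  refine (inv_two_mul_le_of_sum_pow_eq_half (by omega) (root_nonneg J) (root_lt_one J)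
    (sum_root_pow J)).trans ?_
  have hb := one_add_mul_le_pow (a := radius J - 1) (by linarith [radius_pos J])
    (J + 1).factorial
  rw [add_sub_cancel, radius_pow] at hb
  linarith

/-- The zeros of the `J`-th factor lying over the root `root J`. -/
noncomputable def zero (q : Σ J : ℕ, Fin (J + 1).factorial) : ℂ :=
  radius q.1 * Complex.exp (2 * Real.pi * Complex.I / (q.1 + 1).factorial) ^ (q.2 : ℕ)

theorem norm_zero (q : Σ J : ℕ, Fin (J + 1).factorial) : ‖zero q‖ = radius q.1 := by
  rw [zero, norm_mul, norm_pow, (Complex.isPrimitiveRoot_exp _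
    (Nat.factorial_ne_zero (q.1 + 1))).norm'_eq_one (Nat.factorial_ne_zero _), one_pow, mul_one,
    Complex.norm_real, Real.norm_of_nonneg (radius_pos _).le]

theorem zero_pow (q : Σ J : ℕ, Fin (J + 1).factorial) :
    zero q ^ (q.1 + 1).factorial = root q.1 := by
  rw [zero, mul_pow, ← pow_mul, mul_comm (q.2 : ℕ), pow_mul, (Complex.isPrimitiveRoot_exp _
    (Nat.factorial_ne_zero (q.1 + 1))).pow_eq_one, one_pow, mul_one, ← Complex.ofReal_pow,
    radius_pow]

theorem injective_zero : Function.Injective zero := by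
  rintro ⟨J, i⟩ ⟨K, j⟩ h
  have hJK : J = K := strictMono_radius.injective (by
    simpa only [norm_zero] using congrArg norm h)
  subst hJK
  have h' := mul_left_cancel₀ (Complex.ofReal_ne_zero.2 (radius_pos J).ne') h
  have hij := (Complex.isPrimitiveRoot_exp _ (Nat.factorial_ne_zero (J + 1))).pow_inj i.2 j.2 h'
  rw [Fin.ext hij]

theorem not_summable_one_sub_norm_zero : ¬ Summable fun q => 1 - ‖zero q‖ := by
  intro h
  have hs := h.sigma
  simp only [norm_zero, tsum_fintype, Finset.sum_const, Finset.card_univ, Fintype.card_fin,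
    nsmul_eq_mul] at hs
  have h2 : Summable fun J : ℕ => 1 / (2 * ((J + 1 : ℕ) : ℝ)) :=
    hs.of_nonneg_of_le (fun J => by positivity) one_div_le_factorial_mul_one_sub_radius
  have h3 : Summable fun J : ℕ => 1 / ((J + 1 : ℕ) : ℝ) := by
    refine (h2.mul_left 2).congr fun J => ?_
    field_simp
  exact Real.not_summable_one_div_natCast
    ((summable_nat_add_iff (f := fun n : ℕ => 1 / (n : ℝ)) 1).1 h3)

/-- A nonzero function that vanishes at the terms of an injective sequence witnesses that the
sequence is a zero set. -/
theorem isZeroSet_of_injective {p : ℝ≥0∞} {w : ℕ → 𝔻} (hw : Function.Injective w) (f : EllA p)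
    (hf : f ≠ 0) (hfw : ∀ k, f.eval (w k) = 0) : IsZeroSet p w := by
  intro h
  refine hf (Set.mem_singleton_iff.1 (h ▸ fun s m hm => ?_))
  have hle : {k : ℕ | w k = s}.encard ≤ 1 :=
    Set.encard_le_one_iff.2 fun a b ha hb => hw (ha.trans hb.symm)
  obtain rfl : m = 0 := by
    have := hm.trans_le hle
    exact Nat.lt_one_iff.1 (by exact_mod_cast this)
  obtain ⟨k, rfl⟩ := Set.encard_pos.1 (lt_of_le_of_lt (by simp) hm)
  rw [iteratedDeriv_zero]
  exact hfw k

end EllA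

open EllA in
theorem theorem1p2 (p : ℝ) (hp : 2 < p) :
    ∃ w : ℕ → 𝔻, ¬ IsBlaschke w ∧ EllA.IsZeroSet (ENNReal.ofReal p) w := by
  have hlt : ∀ q, ‖zero q‖ < 1 := fun q => (norm_zero q).trans_lt (radius_lt_one _)
  have hinf : Infinite (Σ J : ℕ, Fin (J + 1).factorial) :=
    Infinite.of_injective (fun J : ℕ => ⟨J, ⟨0, Nat.factorial_pos _⟩⟩) fun _ _ h =>
      congrArg Sigma.fst h
  obtain ⟨hden⟩ := nonempty_denumerable (Σ J : ℕ, Fin (J + 1).factorial)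
  let e := (Denumerable.eqv (Σ J : ℕ, Fin (J + 1).factorial)).symm
  let f : EllA (ENNReal.ofReal p) := ⟨coeff, memℓp_coeff hp⟩
  refine ⟨fun k => Complex.UnitDisc.mk (zero (e k)) (hlt _), fun h => ?_,
    isZeroSet_of_injective (fun a b hab => ?_) f (fun h => ?_) fun k => ?_⟩
  · exact not_summable_one_sub_norm_zero (e.summable_iff.1 h)
  · exact e.injective (injective_zero (congrArg ((↑) : 𝔻 → ℂ) hab))
  · exact one_ne_zero (coeff_zero.symm.trans (congrFun (congrArg Subtype.val h) 0))
  · refine tsum_coeff_mul_pow_eq_zero (J := (e k).1)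
      (summable_mul_pow (by simpa using by linarith) f (hlt (e k))) ?_
    simp only [Complex.UnitDisc.coe_mk, zero_pow]
    exact sum_digitCoeff_mul_root_pow _
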